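/- Let $0<s\le k$ be integers, $F\in\mathbb R^{n\times k}$ with rows $F_{1\cdot},\dots,F_{n\cdot}$, and for $x\in\mathbb R^n$ put $F(x):=F^\top\mathrm{Diag}(x)F=\sum_{j=1}^n x_jF_{j\cdot}^\top F_{j\cdot}$. For a symmetric matrix $X$ of order $k$ let $\lambda(X)=(\lambda_1(X)\ge\dots\ge\lambda_k(X))$ be its eigenvalues with multiplicity. A Nikolov index of $\lambda\in\mathbb R^k$ with $\lambda_1\ge\dots\ge\lambda_k$ is an integer $\iota$, $0\le\iota<s$, such that, with $\lambda_0:=+\infty$, $$\lambda_\iota>\frac1{s-\iota}\sum_{\ell=\iota+1}^k\lambda_\ell\ge\lambda_{\iota+1}.$$ There is at most one such integer, and there is exactly one if $\lambda\ge 0$. With $\iota$ the Nikolov index of $\lambda(X)$, let $$\Gamma_s(X):=\sum_{\ell=1}^{\iota}\log\lambda_\ell(X)+(s-\iota)\log\Big(\frac1{s-\iota}\sum_{\ell=\iota+1}^k\lambda_\ell(X)\Big);$$ this is used for positive semidefinite $X$ and, by the same formula, for the other symmetric $X$ for which the index exists (if there is none, put $\iota:=0$ and use the same formula with the convention that $\log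 t$ is $\log|t|$ for $t<0$ and $\log 0=0$). **Theorem.** Let $\hat x\in[0,1]^n$, let $\hat\lambda:=\lambda(F(\hat x))$, let $F(\hat x)=\sum_{\ell=1}^k\hat\lambda_\ell\hat u_\ell\hat u_\ell^\top$ be a spectral decomposition with $\hat u_1,\dots,\hat u_k$ orthonormal, and let $\hat\iota$ be the Nikolov index of $\hat\lambda$. Suppose that $$\frac1{s-\hat\iota}\sum_{\ell=\hat\iota+1}^k\hat\lambda_\ell>\hat\lambda_{\hat\iota+1}.$$ Then the function $x\mapsto\Gamma_s(F(x))$ on $\mathbb R^n$ is differentiable at $\hat x$, and for $j=1,\dots,n$ $$\frac{\partial}{\partial x_j}\Gamma_s(F(\hat x))=\sum_{\ell=1}^{\hat\iota}\frac{1}{\hat\lambda_\ell}(F_{j\cdot}\hat u_\ell)^2+\sum_{\ell=\hat\iota+1}^k\frac{s-\hat\iota}{\sum_{i=\hat\iota+1}^k\hat\lambda_i}(F_{j\cdot}\hat u_\ell)^2 .$$ -/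

import Mathlib

/-- The matrix `F(x) = Fᵀ Diag(x) F = ∑ⱼ xⱼ Fⱼᵀ Fⱼ`, where `Fⱼ` is row `j` of `F`. -/
def factMatrix {n k : ℕ} (F : Matrix (Fin n) (Fin k) ℝ) (x : Fin n → ℝ) :
    Matrix (Fin k) (Fin k) ℝ :=
  F.transpose * Matrix.diagonal x * F

/-- The eigenvalues of a real symmetric matrix, with multiplicity, in nonincreasing order.
The entry with index `l : Fin k` is the `(l+1)`-st greatest eigenvalue.
(Matrices that are not symmetric get the value `0`.) -/
noncomputable def sortedEigenvalues {k : ℕ} (X : Matrix (Fin k) (Fin k) ℝ) : Fin k → ℝ :=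
  open Classical in
  if h : X.IsHermitian then
    fun l => h.eigenvalues₀ (Fin.cast (Fintype.card_fin k).symm l)
  else 0

/-- The sum `λ_{i+1} + ⋯ + λ_k` (one-based numbering; the zero-based indices are `l ≥ i`). -/
noncomputable def tailSum {k : ℕ} (lam : Fin k → ℝ) (i : ℕ) : ℝ :=
  ∑ l : Fin k with i ≤ l.val, lam l

/-- `i` is an integer with `0 ≤ i < s` and
`λ_i > (1/(s-i)) (λ_{i+1} + ⋯ + λ_k) ≥ λ_{i+1}` (one-based numbering), where `λ_0 = +∞`. -/
def IsNikolovIndex {k : ℕ} (s : ℕ) (lam : Fin k → ℝ) (i : ℕ) : Prop :=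
  i < s ∧
  (∀ l : Fin k, (l : ℕ) + 1 = i → 1 / ((s : ℝ) - i) * tailSum lam i < lam l) ∧
  (∀ l : Fin k, (l : ℕ) = i → lam l ≤ 1 / ((s : ℝ) - i) * tailSum lam i)

theorem tailSum_eq_add {k : ℕ} (lam : Fin k → ℝ) (i : ℕ) (hi : i < k) :
    tailSum lam i = lam ⟨i, hi⟩ + tailSum lam (i + 1) := by
  unfold tailSum
  have h : (Finset.univ.filter fun l : Fin k => i ≤ l.val)
      = insert ⟨i, hi⟩ (Finset.univ.filter fun l : Fin k => i + 1 ≤ l.val) := by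
    ext l
    simp only [Finset.mem_filter, Finset.mem_univ, true_and, Finset.mem_insert, Fin.ext_iff]
    omega
  rw [h, Finset.sum_insert (by simp)]

/-- A nonincreasing vector has at most one Nikolov index, and one that is in addition
nonnegative has exactly one. -/
theorem isNikolovIndex_unique {k s : ℕ} (hsk : s ≤ k) {lam : Fin k → ℝ}
    (hanti : Antitone lam) {i j : ℕ}
    (hi : IsNikolovIndex s lam i) (hj : IsNikolovIndex s lam j) : i = j := by
  have key : ∀ i j : ℕ, IsNikolovIndex s lam i → IsNikolovIndex s lam j → ¬ i < j := by
    intro i j hi hj hij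
    have hmono : ∀ m, i ≤ m → ∀ hm : m < s,
        ((s : ℝ) - m) * lam ⟨m, hm.trans_le hsk⟩ ≤ tailSum lam m := by
      intro m him
      induction m, him using Nat.le_induction with
      | base =>
        intro hm
        have h := hi.2.2 ⟨i, hm.trans_le hsk⟩ rfl
        have hp : (0 : ℝ) < (s : ℝ) - i := by
          have : (i : ℝ) < s := by exact_mod_cast hm
          linarith
        rw [one_div, inv_mul_eq_div, le_div_iff₀ hp] at h
        linarith
      | succ m him ih =>
        intro hm
        have h := ih (by omega)
        rw [tailSum_eq_add lam m (by omega)] at h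
        have hle : lam ⟨m + 1, hm.trans_le hsk⟩ ≤ lam ⟨m, by omega⟩ :=
          hanti (by simp [Fin.le_def])
        have hp : (0 : ℝ) ≤ (s : ℝ) - m - 1 := by
          have : ((m + 1 : ℕ) : ℝ) < s := by exact_mod_cast hm
          push_cast at this
          linarith
        push_cast
        nlinarith [mul_le_mul_of_nonneg_left hle hp]
    obtain ⟨m, rfl⟩ : ∃ m, j = m + 1 := ⟨j - 1, by omega⟩
    have hm1 : m + 1 < s := hj.1
    have h1 := hmono m (by omega) (by omega)
    rw [tailSum_eq_add lam m (by omega)] at h1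
    have h2 := hj.2.1 ⟨m, by omega⟩ rfl
    have hp : (0 : ℝ) < (s : ℝ) - (m + 1 : ℕ) := by
      have : ((m + 1 : ℕ) : ℝ) < s := by exact_mod_cast hm1
      linarith
    rw [one_div, inv_mul_eq_div, div_lt_iff₀ hp] at h2
    push_cast at h2
    linarith
  have h1 := key i j hi hj
  have h2 := key j i hj hi
  omega

theorem exists_isNikolovIndex {k s : ℕ} (hs : 0 < s) (hsk : s ≤ k) {lam : Fin k → ℝ}
    (hnonneg : ∀ l, 0 ≤ lam l) : ∃ i, IsNikolovIndex s lam i := by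
  classical
  have hex : ∃ i, ∃ hi : i < s,
      lam ⟨i, hi.trans_le hsk⟩ ≤ 1 / ((s : ℝ) - i) * tailSum lam i := by
    refine ⟨s - 1, by omega, ?_⟩
    have hc : ((s - 1 : ℕ) : ℝ) = (s : ℝ) - 1 := by
      rw [Nat.cast_sub (by omega)]; simp
    rw [hc, tailSum_eq_add lam (s - 1) (by omega)]
    have : 0 ≤ tailSum lam (s - 1 + 1) := Finset.sum_nonneg fun l _ => hnonneg l
    simp only [sub_sub_cancel, div_one, one_mul]
    linarith
  obtain ⟨hi, hle⟩ := Nat.find_spec hex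
  refine ⟨Nat.find hex, hi, ?_, ?_⟩
  · intro l hl
    have hmin := Nat.find_min hex (m := l) (by omega)
    push Not at hmin
    have h := hmin (by omega)
    have hcast : ((Nat.find hex : ℕ) : ℝ) = (l : ℕ) + 1 := by rw [← hl]; push_cast; rfl
    have his : ((Nat.find hex : ℕ) : ℝ) < s := by exact_mod_cast hi
    rw [one_div, inv_mul_eq_div, div_lt_iff₀ (by linarith)] at h ⊢
    rw [tailSum_eq_add lam l l.2, hl] at h
    rw [hcast]
    simp only [Fin.eta] at h
    linarith
  · intro l hl
    have : l = ⟨Nat.find hex, hi.trans_le hsk⟩ := Fin.ext hl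
    rw [this]
    exact hle

/-- The Nikolov index of a nonincreasing vector (which has at most one). If there is none,
which does not happen for nonnegative vectors when `0 < s ≤ k`, the value is `0`. -/
noncomputable def nikolovIndex {k : ℕ} (s : ℕ) (lam : Fin k → ℝ) : ℕ :=
  sInf {i | IsNikolovIndex s lam i}

/-- `φ_s(λ) = ∑_{l ≤ ι} log λ_l + (s - ι) log ((1/(s-ι)) ∑_{l > ι} λ_l)`,
where `ι` is the Nikolov index of `λ`. -/
noncomputable def phi {k : ℕ} (s : ℕ) (lam : Fin k → ℝ) : ℝ :=
  (∑ l : Fin k with l.val < nikolovIndex s lam, Real.log (lam l)) +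
    ((s : ℝ) - nikolovIndex s lam) *
      Real.log (1 / ((s : ℝ) - nikolovIndex s lam) * tailSum lam (nikolovIndex s lam))

/-- `Γ_s(X) = φ_s(λ_1(X), …, λ_k(X))`. For symmetric matrices that are not positive
semidefinite, the same formula is used. -/
noncomputable def Gam {k : ℕ} (s : ℕ) (X : Matrix (Fin k) (Fin k) ℝ) : ℝ :=
  phi s (sortedEigenvalues X)

/-!
Write `λ` for the sorted eigenvalues of `X`, `ι` for their Nikolov index, `a` for the tail mean
`(λ_{ι+1} + ⋯ + λ_k) / (s - ι)`, and let `G(X)` be the matrix with the eigenvectors of `X` and the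
eigenvalues `1 / max (λ_l, a)`. These are `1 / λ_l` for `l ≤ ι` and `1 / a` for `l > ι`, so `G(X)`
is the candidate for the gradient of `Γ_s` at `X`. It remains to bound the deviation of `Γ_s` from
its linearization, and no smoothness of eigenvectors is needed for that.

For orthonormal bases `u` and `v` the squared inner products `⟨u_l, v_m⟩²` form a doubly stochastic
matrix (`overlap_mem_doublyStochastic`), and traces of products of matrices diagonal in these bases
are averages of products of eigenvalues with these weights (`trace_sub_mul_sub_dyadSum`). Birkhoff's
theorem and the rearrangement inequality (`Antivary.sum_mul_le_sum_doublyStochastic`) then give two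
facts.

* The Hoffman-Wielandt inequality `∑ (μ_l - λ_l)² ≤ ‖Y - X‖²` in the Frobenius norm
  (`sum_sq_sub_le_trace_sq`). Hence the eigenvalues depend continuously on the matrix, and, since
  both inequalities defining the index are strict at `x̂`, the index is constant near `x̂`.
* `G(X)` is a supergradient: `Γ_s(Y) ≤ Γ_s(X) + tr (G(X) (Y - X))` when `X` and `Y` have the same
  index and positive tail means. For vectors of eigenvalues this is the bound of the logarithm by
  its tangents (`phi_le_add_sum_phiWeight`).

Exchanging `X` and `Y` in the second fact shows that
`Γ_s(Y) - Γ_s(X) - tr (G(X) (Y - X))` lies between `tr ((G(Y) - G(X)) (Y - X))` and `0`. The former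
is again a doubly stochastic average of products of differences of eigenvalues, and since
`(t, a) ↦ 1 / max (t, a)` is Lipschitz for `a` away from `0` it is `O(‖Y - X‖²)`
(`abs_phi_sub_sub_trace_le`). With `X = F(x̂)` and `Y = F(x)` this is differentiability at `x̂`, with the partial
derivatives read off from `tr (G(X) F(x))`.
-/

/-! ### Spectral decompositions and the matrix `F(x)` -/

/-- The symmetric matrix `∑ₗ αₗ wₗ wₗᵀ`. If the `wₗ` form an orthonormal basis, this is the
spectral decomposition of the matrix with eigenpairs `(αₗ, wₗ)`. -/
def dyadSum {ι κ : Type*} [Fintype ι] (w : ι → κ → ℝ) (α : ι → ℝ) : Matrix κ κ ℝ :=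
  ∑ l, α l • Matrix.vecMulVec (w l) (w l)

theorem dyadSum_sub {ι κ : Type*} [Fintype ι] (w : ι → κ → ℝ) (α β : ι → ℝ) :
    dyadSum w (α - β) = dyadSum w α - dyadSum w β := by
  simp [dyadSum, sub_smul]

theorem trace_dyadSum_mul_dyadSum {ι ι' κ : Type*} [Fintype ι] [Fintype ι'] [Fintype κ]
    (w : ι → κ → ℝ) (z : ι' → κ → ℝ) (α : ι → ℝ) (β : ι' → ℝ) :
    (dyadSum w α * dyadSum z β).trace = ∑ l, ∑ m, (w l ⬝ᵥ z m) ^ 2 * (α l * β m) := by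
  simp only [dyadSum, Matrix.sum_mul, Matrix.mul_sum, Matrix.trace_sum, Matrix.smul_mul,
    Matrix.mul_smul, Matrix.trace_smul, Matrix.vecMulVec_mul_vecMulVec, Matrix.trace_vecMulVec,
    dotProduct_smul, smul_eq_mul]
  rw [Finset.sum_comm]
  refine Finset.sum_congr rfl fun m _ => ?_
  rw [Finset.mul_sum]
  exact Finset.sum_congr rfl fun l _ => by ring

theorem factMatrix_eq_dyadSum {n k : ℕ} (F : Matrix (Fin n) (Fin k) ℝ) (x : Fin n → ℝ) :
    factMatrix F x = dyadSum F.row x := by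
  ext i j
  simp only [factMatrix, dyadSum, Matrix.mul_apply (N := F), Matrix.mul_diagonal,
    Matrix.transpose_apply, Matrix.sum_apply, Matrix.smul_apply, Matrix.vecMulVec_apply,
    Matrix.row_apply, smul_eq_mul]
  refine Finset.sum_congr rfl fun l _ => ?_
  ring

theorem isHermitian_factMatrix {n k : ℕ} (F : Matrix (Fin n) (Fin k) ℝ) (x : Fin n → ℝ) :
    (factMatrix F x).IsHermitian := by
  rw [Matrix.IsHermitian, Matrix.conjTranspose_eq_transpose_of_trivial]
  simp [factMatrix, Matrix.mul_assoc]

theorem posSemidef_factMatrix {n k : ℕ} (F : Matrix (Fin n) (Fin k) ℝ) {x : Fin n → ℝ}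
    (hx : 0 ≤ x) : (factMatrix F x).PosSemidef := by
  have h := (Matrix.PosSemidef.diagonal hx).conjTranspose_mul_mul_same F
  rwa [Matrix.conjTranspose_eq_transpose_of_trivial] at h

theorem sortedEigenvalues_antitone {k : ℕ} {X : Matrix (Fin k) (Fin k) ℝ}
    (hX : X.IsHermitian) : Antitone (sortedEigenvalues X) := by
  rw [sortedEigenvalues, dif_pos hX]
  exact fun l m hlm => hX.eigenvalues₀_antitone (Fin.cast_le_cast _ |>.2 hlm)

theorem exists_equiv_sortedEigenvalues {k : ℕ} {X : Matrix (Fin k) (Fin k) ℝ}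
    (hX : X.IsHermitian) :
    ∃ e : Fin k ≃ Fin k, ∀ l, sortedEigenvalues X l = hX.eigenvalues (e l) := by
  refine ⟨(finCongr (Fintype.card_fin k).symm).trans
    (Fintype.equivOfCardEq (Fintype.card_fin _)), fun l => ?_⟩
  rw [sortedEigenvalues, dif_pos hX]
  simp [Matrix.IsHermitian.eigenvalues]

theorem sortedEigenvalues_nonneg {k : ℕ} {X : Matrix (Fin k) (Fin k) ℝ}
    (hX : X.PosSemidef) (l : Fin k) : 0 ≤ sortedEigenvalues X l := by
  obtain ⟨e, he⟩ := exists_equiv_sortedEigenvalues hX.1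
  rw [he]
  exact hX.eigenvalues_nonneg _

/-- The spectral theorem, with the eigenvalues listed in nonincreasing order. -/
theorem exists_orthonormal_eq_dyadSum {k : ℕ} {X : Matrix (Fin k) (Fin k) ℝ}
    (hX : X.IsHermitian) :
    ∃ v : Fin k → EuclideanSpace ℝ (Fin k), Orthonormal ℝ v ∧
      X = dyadSum (fun l i => v l i) (sortedEigenvalues X) := by
  obtain ⟨e, he⟩ := exists_equiv_sortedEigenvalues hX
  refine ⟨fun l => hX.eigenvectorBasis (e l),
    hX.eigenvectorBasis.orthonormal.comp e e.injective, ?_⟩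
  ext i j
  have h : X i j = ∑ l, hX.eigenvalues l * (hX.eigenvectorBasis l i * hX.eigenvectorBasis l j) := by
    conv_lhs => rw [hX.spectral_theorem, Unitary.conjStarAlgAut_apply, Matrix.mul_apply]
    simp only [ Matrix.mul_diagonal, Matrix.star_apply,
      Matrix.IsHermitian.eigenvectorUnitary_apply, Function.comp_apply, star_trivial]
    refine Finset.sum_congr rfl fun l _ => ?_
    simp only [RCLike.ofReal_real_eq_id, id_eq]
    ring
  rw [h, ← Equiv.sum_comp e]
  simp [dyadSum, Matrix.sum_apply, Matrix.vecMulVec_apply, he]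

/-! ### Doubly stochastic overlaps and trace inequalities -/

/-- The squared inner products `⟨u_l, v_m⟩²` of two families of vectors. -/
def overlap {k : ℕ} (u v : Fin k → EuclideanSpace ℝ (Fin k)) : Matrix (Fin k) (Fin k) ℝ :=
  Matrix.of fun l m => ((fun i => u l i) ⬝ᵥ (fun i => v m i)) ^ 2

theorem overlap_mem_doublyStochastic {k : ℕ} {u v : Fin k → EuclideanSpace ℝ (Fin k)}
    (hu : Orthonormal ℝ u) (hv : Orthonormal ℝ v) :
    overlap u v ∈ doublyStochastic ℝ (Fin k) := by
  have hspan : ∀ {w : Fin k → EuclideanSpace ℝ (Fin k)}, Orthonormal ℝ w →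
      ∃ b : OrthonormalBasis (Fin k) ℝ (EuclideanSpace ℝ (Fin k)), ⇑b = w := fun {w} hw =>
    ⟨OrthonormalBasis.mk hw
      (hw.linearIndependent.span_eq_top_of_card_eq_finrank' (by simp)).ge, by simp⟩
  obtain ⟨b, rfl⟩ := hspan hu
  obtain ⟨c, rfl⟩ := hspan hv
  have hov : ∀ l m, overlap b c l m = inner ℝ (b l) (c m) ^ 2 := fun l m => by
    rw [EuclideanSpace.inner_eq_star_dotProduct, dotProduct_comm]
    simp [overlap]
  rw [mem_doublyStochastic_iff_sum]
  refine ⟨fun l m => by rw [hov]; positivity, fun l => ?_, fun m => ?_⟩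
  · simp_rw [hov]
    rw [c.sum_sq_inner_left, b.orthonormal.1]
    norm_num
  · simp_rw [hov]
    rw [b.sum_sq_inner_right, c.orthonormal.1]
    norm_num

/-- A doubly stochastic average of the products `fₗ gₘ` is at least the sum of the products taken
in opposite order: by Birkhoff's theorem it is an average over permutations, to each of which
the rearrangement inequality applies. -/
theorem Antivary.sum_mul_le_sum_doublyStochastic {ι : Type*} [Fintype ι] [DecidableEq ι]
    {f g : ι → ℝ} (hfg : Antivary f g) {P : Matrix ι ι ℝ} (hP : P ∈ doublyStochastic ℝ ι) :
    ∑ l, f l * g l ≤ ∑ l, ∑ m, P l m * (f l * g m) := by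
  obtain ⟨w, hw0, hw1, rfl⟩ := exists_eq_sum_perm_of_mem_doublyStochastic hP
  have h : ∑ l, ∑ m, (∑ σ, w σ • σ.permMatrix ℝ) l m * (f l * g m)
      = ∑ σ : Equiv.Perm ι, w σ * ∑ l, f l * g (σ l) := by
    simp only [Matrix.sum_apply, Matrix.smul_apply, Finset.sum_mul, Finset.mul_sum]
    simp_rw [Finset.sum_comm (t := (Finset.univ : Finset (Equiv.Perm ι)))]
    refine Finset.sum_congr rfl fun σ _ => Finset.sum_congr rfl fun l _ => ?_
    simp [PEquiv.toMatrix_apply, Equiv.toPEquiv_apply]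
  rw [h]
  calc ∑ l, f l * g l = ∑ σ : Equiv.Perm ι, w σ * ∑ l, f l * g l := by
        rw [← Finset.sum_mul, hw1, one_mul]
    _ ≤ _ := Finset.sum_le_sum fun σ _ =>
        mul_le_mul_of_nonneg_left hfg.sum_mul_le_sum_mul_comp_perm (hw0 σ)

/-- The bilinear expression behind all the perturbation estimates: for two matrices with
eigenvectors `u` and two with eigenvectors `v`, the trace of the product of the differences is a
weighted sum of products of differences of eigenvalues. -/
theorem trace_sub_mul_sub_dyadSum {k : ℕ} {u v : Fin k → EuclideanSpace ℝ (Fin k)}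
    (hu : Orthonormal ℝ u) (hv : Orthonormal ℝ v) (α β α' β' : Fin k → ℝ) :
    ((dyadSum (fun l i => v l i) α' - dyadSum (fun l i => u l i) α) *
      (dyadSum (fun l i => v l i) β' - dyadSum (fun l i => u l i) β)).trace =
      ∑ l, ∑ m, overlap u v l m * ((α' m - α l) * (β' m - β l)) := by
  have hself : ∀ {w : Fin k → EuclideanSpace ℝ (Fin k)}, Orthonormal ℝ w → ∀ f g : Fin k → ℝ,
      (dyadSum (fun l i => w l i) f * dyadSum (fun l i => w l i) g).trace = ∑ l, f l * g l := by
    intro w hw f g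
    rw [trace_dyadSum_mul_dyadSum]
    have hortho : ∀ l m, ((fun i => w l i) ⬝ᵥ (fun i => w m i)) = if l = m then 1 else 0 := by
      intro l m
      rw [← orthonormal_iff_ite.1 hw l m, EuclideanSpace.inner_eq_star_dotProduct,
        dotProduct_comm]
      simp
    simp [hortho]
  have hP := overlap_mem_doublyStochastic hu hv
  simp only [sub_mul, mul_sub, Matrix.trace_sub, hself hu, hself hv]
  rw [Matrix.trace_mul_comm (dyadSum (fun l i => v l i) α')]
  simp only [trace_dyadSum_mul_dyadSum]
  have h1 : ∑ l, α' l * β' l = ∑ l, ∑ m, overlap u v l m * (α' m * β' m) := by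
    rw [Finset.sum_comm]
    simp_rw [← Finset.sum_mul, sum_col_of_mem_doublyStochastic hP, one_mul]
  have h2 : ∑ l, α l * β l = ∑ l, ∑ m, overlap u v l m * (α l * β l) := by
    simp_rw [← Finset.sum_mul, sum_row_of_mem_doublyStochastic hP, one_mul]
  rw [h1, h2]
  simp only [← Finset.sum_sub_distrib]
  refine Finset.sum_congr rfl fun l _ => Finset.sum_congr rfl fun m _ => ?_
  simp only [overlap, Matrix.of_apply]
  ring

/-- The Hoffman-Wielandt inequality: the sorted eigenvalues are at most as far apart as the
matrices are in the Frobenius norm. -/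
theorem sum_sq_sub_le_trace_sq {k : ℕ} {u v : Fin k → EuclideanSpace ℝ (Fin k)}
    (hu : Orthonormal ℝ u) (hv : Orthonormal ℝ v) {lam mu : Fin k → ℝ}
    (hlam : Antitone lam) (hmu : Antitone mu) :
    ∑ l, (mu l - lam l) ^ 2 ≤
      ((dyadSum (fun l i => v l i) mu - dyadSum (fun l i => u l i) lam) *
        (dyadSum (fun l i => v l i) mu - dyadSum (fun l i => u l i) lam)).trace := by
  have hP := overlap_mem_doublyStochastic hu hv
  have hanti : Antivary (fun l => -lam l) mu := fun l m h =>
    neg_le_neg (hlam (le_of_lt (not_le.1 fun hle => absurd (hmu hle) (not_le.2 h))))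
  have h := hanti.sum_mul_le_sum_doublyStochastic hP
  rw [trace_sub_mul_sub_dyadSum hu hv]
  have h1 : ∑ l, ∑ m, overlap u v l m * (mu m ^ 2) = ∑ l, mu l ^ 2 := by
    rw [Finset.sum_comm]
    simp_rw [← Finset.sum_mul, sum_col_of_mem_doublyStochastic hP, one_mul]
  have h2 : ∑ l, ∑ m, overlap u v l m * (lam l ^ 2) = ∑ l, lam l ^ 2 := by
    simp_rw [← Finset.sum_mul, sum_row_of_mem_doublyStochastic hP, one_mul]
  have e1 : ∑ l, (mu l - lam l) ^ 2
      = ∑ l, mu l ^ 2 + ∑ l, lam l ^ 2 + 2 * ∑ l, -lam l * mu l := by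
    rw [Finset.mul_sum, ← Finset.sum_add_distrib, ← Finset.sum_add_distrib]
    exact Finset.sum_congr rfl fun l _ => by ring
  have e2 : ∑ l, ∑ m, overlap u v l m * ((mu m - lam l) * (mu m - lam l))
      = ∑ l, mu l ^ 2 + ∑ l, lam l ^ 2 + 2 * ∑ l, ∑ m, overlap u v l m * (-lam l * mu m) := by
    rw [← h1, ← h2]
    simp only [Finset.mul_sum, ← Finset.sum_add_distrib]
    exact Finset.sum_congr rfl fun l _ => Finset.sum_congr rfl fun m _ => by ring
  rw [e1, e2]
  linarith

/-! ### The function `φ_s` near a vector with a given Nikolov index -/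

/-- The mean `(λ_{i+1} + ⋯ + λ_k) / (s - i)` (one-based numbering) that is compared with the
entries of `λ` in the definition of the Nikolov index. -/
noncomputable def tailMean {k : ℕ} (s : ℕ) (lam : Fin k → ℝ) (i : ℕ) : ℝ :=
  1 / ((s : ℝ) - i) * tailSum lam i

/-- The weight `1 / max (λ_l, a)`, where `a` is the tail mean of `λ`. If `i` is the Nikolov index
of `λ`, it is `1 / λ_l` for the first `i` entries and `1 / a` for the others. -/
noncomputable def phiWeight {k : ℕ} (s : ℕ) (lam : Fin k → ℝ) (i : ℕ) (l : Fin k) : ℝ :=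
  1 / max (lam l) (tailMean s lam i)

theorem phiWeight_monotone {k s i : ℕ} {lam : Fin k → ℝ} (hanti : Antitone lam)
    (ha : 0 < tailMean s lam i) : Monotone (phiWeight s lam i) := fun _ _ hlm =>
  one_div_le_one_div_of_le (lt_max_of_lt_right ha) (max_le_max_right _ (hanti hlm))

theorem nikolovIndex_eq {k s i : ℕ} (hsk : s ≤ k) {lam : Fin k → ℝ} (hanti : Antitone lam)
    (hi : IsNikolovIndex s lam i) : nikolovIndex s lam = i := by
  have h : {j | IsNikolovIndex s lam j} = {i} :=
    Set.eq_singleton_iff_unique_mem.2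
      ⟨hi, fun j hj => isNikolovIndex_unique hsk hanti hj hi⟩
  rw [nikolovIndex, h, csInf_singleton]

theorem phi_eq {k s i : ℕ} (hsk : s ≤ k) {lam : Fin k → ℝ} (hanti : Antitone lam)
    (hi : IsNikolovIndex s lam i) :
    phi s lam = (∑ l : Fin k with l.val < i, Real.log (lam l)) +
      ((s : ℝ) - i) * Real.log (tailMean s lam i) := by
  rw [phi, nikolovIndex_eq hsk hanti hi, tailMean]

namespace IsNikolovIndex

variable {k s i : ℕ} {lam : Fin k → ℝ}

theorem one_le_sub (hi : IsNikolovIndex s lam i) : 1 ≤ (s : ℝ) - i := by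
  have : ((i + 1 : ℕ) : ℝ) ≤ s := by exact_mod_cast hi.1
  push_cast at this
  linarith

theorem tailMean_lt (hi : IsNikolovIndex s lam i) (hanti : Antitone lam) {l : Fin k}
    (hl : l.val < i) (hsk : s ≤ k) : tailMean s lam i < lam l := by
  have hik : i < k := hi.1.trans_le hsk
  have h := hi.2.1 ⟨i - 1, by omega⟩ (by simp only; omega)
  exact h.trans_le (hanti (by rw [Fin.le_def]; simp only; omega))

theorem le_tailMean (hi : IsNikolovIndex s lam i) (hanti : Antitone lam) {l : Fin k}
    (hl : i ≤ l.val) : lam l ≤ tailMean s lam i :=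
  (hanti (show (⟨i, hl.trans_lt l.2⟩ : Fin k) ≤ l from hl)).trans (hi.2.2 _ rfl)

theorem phiWeight_of_lt (hi : IsNikolovIndex s lam i) (hanti : Antitone lam) {l : Fin k}
    (hl : l.val < i) (hsk : s ≤ k) : phiWeight s lam i l = 1 / lam l := by
  rw [phiWeight, max_eq_left (hi.tailMean_lt hanti hl hsk).le]

theorem phiWeight_of_ge (hi : IsNikolovIndex s lam i) (hanti : Antitone lam) {l : Fin k}
    (hl : i ≤ l.val) : phiWeight s lam i l = 1 / tailMean s lam i := by
  rw [phiWeight, max_eq_right (hi.le_tailMean hanti hl)]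

end IsNikolovIndex

theorem Real.log_le_log_add_one_div_mul_sub {x y : ℝ} (hx : 0 < x) (hy : 0 < y) :
    Real.log y ≤ Real.log x + 1 / x * (y - x) := by
  have h := Real.log_le_sub_one_of_pos (div_pos hy hx)
  rw [Real.log_div hy.ne' hx.ne'] at h
  have e : 1 / x * (y - x) = y / x - 1 := by field_simp
  linarith

/-- The weights `phiWeight` form a supergradient of `φ_s` with respect to all vectors with the
same Nikolov index, because the logarithm is below its tangents. -/
theorem phi_le_add_sum_phiWeight {k s i : ℕ} (hsk : s ≤ k) {lam mu : Fin k → ℝ}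
    (hlam : Antitone lam) (hmu : Antitone mu)
    (hi : IsNikolovIndex s lam i) (hj : IsNikolovIndex s mu i)
    (ha : 0 < tailMean s lam i) (hb : 0 < tailMean s mu i) :
    phi s mu ≤ phi s lam + ∑ l, phiWeight s lam i l * (mu l - lam l) := by
  rw [phi_eq hsk hlam hi, phi_eq hsk hmu hj,
    ← Finset.sum_filter_add_sum_filter_not Finset.univ (fun l : Fin k => l.val < i)
      (fun l => phiWeight s lam i l * (mu l - lam l))]
  have hs := hi.one_le_sub
  have h1 : ∑ l : Fin k with l.val < i, Real.log (mu l) ≤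
      (∑ l : Fin k with l.val < i, Real.log (lam l)) +
        ∑ l : Fin k with l.val < i, phiWeight s lam i l * (mu l - lam l) := by
    rw [← Finset.sum_add_distrib]
    refine Finset.sum_le_sum fun l hl => ?_
    have hl' : l.val < i := (Finset.mem_filter.1 hl).2
    rw [hi.phiWeight_of_lt hlam hl' hsk]
    exact Real.log_le_log_add_one_div_mul_sub (ha.trans (hi.tailMean_lt hlam hl' hsk))
      (hb.trans (hj.tailMean_lt hmu hl' hsk))
  have h2 : ∑ l : Fin k with ¬ l.val < i, phiWeight s lam i l * (mu l - lam l) =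
      ((s : ℝ) - i) * (1 / tailMean s lam i * (tailMean s mu i - tailMean s lam i)) := by
    have e : ∀ nu : Fin k → ℝ, ((s : ℝ) - i) * tailMean s nu i = tailSum nu i := fun nu => by
      rw [tailMean, one_div, mul_inv_cancel_left₀ (by linarith)]
    rw [mul_left_comm, mul_sub, e, e, tailSum, tailSum, ← Finset.sum_sub_distrib, Finset.mul_sum]
    refine Finset.sum_congr (by simp) fun l hl => ?_
    rw [hi.phiWeight_of_ge hlam (Finset.mem_filter.1 hl).2]
  -- On the tail the weights are constant, so only the tail means of `μ` and `λ` matter, and one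
  -- tangent inequality suffices.
  have h3 := mul_le_mul_of_nonneg_left (Real.log_le_log_add_one_div_mul_sub ha hb)
    (zero_le_one.trans hs)
  rw [h2]
  rw [mul_add] at h3
  linarith

theorem sq_tailMean_sub_le {k s i : ℕ} {lam mu : Fin k → ℝ} (hi : IsNikolovIndex s lam i) :
    (tailMean s mu i - tailMean s lam i) ^ 2 ≤ k * ∑ l, (mu l - lam l) ^ 2 := by
  have hs := hi.one_le_sub
  have e : tailMean s mu i - tailMean s lam i =
      1 / ((s : ℝ) - i) * ∑ l : Fin k with i ≤ l.val, (mu l - lam l) := by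
    rw [Finset.sum_sub_distrib, tailMean, tailMean, tailSum, tailSum, mul_sub]
  have h1 : (1 / ((s : ℝ) - i)) ^ 2 ≤ 1 :=
    pow_le_one₀ (by positivity) ((div_le_one (by linarith)).2 hs)
  have h2 : ((Finset.univ.filter fun l : Fin k => i ≤ l.val).card : ℝ) ≤ k := by
    exact_mod_cast (Finset.card_filter_le _ _).trans (by simp)
  rw [e, mul_pow]
  calc _ ≤ 1 * (∑ l : Fin k with i ≤ l.val, (mu l - lam l)) ^ 2 := by gcongr
    _ ≤ ((Finset.univ.filter fun l : Fin k => i ≤ l.val).card : ℝ) *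
          ∑ l : Fin k with i ≤ l.val, (mu l - lam l) ^ 2 := by
        rw [one_mul]; exact sq_sum_le_card_mul_sum_sq
    _ ≤ k * ∑ l, (mu l - lam l) ^ 2 := by
        gcongr
        exact Finset.subset_univ _

theorem abs_one_div_max_sub_le {a b x y : ℝ} (ha : 0 < a) (hb : a / 2 ≤ b) :
    |1 / max y b - 1 / max x a| ≤ 2 / a ^ 2 * (|y - x| + |b - a|) := by
  have hp : a ≤ max x a := le_max_right _ _
  have hq : a / 2 ≤ max y b := hb.trans (le_max_right _ _)
  have hp0 : 0 < max x a := ha.trans_le hp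
  have hq0 : 0 < max y b := (half_pos ha).trans_le hq
  have hmax : |max x a - max y b| ≤ |y - x| + |b - a| := by
    refine (abs_max_sub_max_le_max x a y b).trans ?_
    rw [abs_sub_comm x, abs_sub_comm a]
    exact max_le_add_of_nonneg (abs_nonneg _) (abs_nonneg _)
  rw [div_sub_div _ _ hq0.ne' hp0.ne', one_mul, mul_one, abs_div, abs_of_pos (mul_pos hq0 hp0),
    div_mul_eq_mul_div, div_le_div_iff₀ (mul_pos hq0 hp0) (by positivity)]
  have hprod : a ^ 2 ≤ 2 * (max y b * max x a) := by nlinarith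
  calc |max x a - max y b| * a ^ 2
      ≤ (|y - x| + |b - a|) * (2 * (max y b * max x a)) := by gcongr
    _ = _ := by ring

/-! ### The second-order estimate and differentiability -/

/-- The deviation of `Γ_s` from its linearization is of second order. The linearization at `X` is
an upper bound for the value at `Y`, and the linearization at `Y` is one for the value at `X`;
so the deviation is at most the trace of the product of `Y - X` with the difference of the two
gradients, and the gradient is Lipschitz in the Frobenius norm. -/
theorem abs_phi_sub_sub_trace_le {k s i : ℕ} (hsk : s ≤ k) {lam mu : Fin k → ℝ}
    (hlam : Antitone lam) (hmu : Antitone mu)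
    (hi : IsNikolovIndex s lam i) (hj : IsNikolovIndex s mu i)
    (ha : 0 < tailMean s lam i) (hb : tailMean s lam i / 2 ≤ tailMean s mu i)
    {u v : Fin k → EuclideanSpace ℝ (Fin k)} (hu : Orthonormal ℝ u) (hv : Orthonormal ℝ v)
    {X Y : Matrix (Fin k) (Fin k) ℝ}
    (hX : X = dyadSum (fun l i => u l i) lam) (hY : Y = dyadSum (fun l i => v l i) mu) :
    |phi s mu - phi s lam -
        (dyadSum (fun l i => u l i) (phiWeight s lam i) * (Y - X)).trace| ≤
      2 / tailMean s lam i ^ 2 * (2 + k ^ 2) * ((Y - X) * (Y - X)).trace := by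
  have hb0 : 0 < tailMean s mu i := (half_pos ha).trans_le hb
  have hP := overlap_mem_doublyStochastic hu hv
  -- The linearization at one matrix is an upper bound at the other.
  have hsuper : ∀ {α β : Fin k → ℝ} {w z : Fin k → EuclideanSpace ℝ (Fin k)},
      Orthonormal ℝ w → Orthonormal ℝ z → Antitone α → Antitone β →
      IsNikolovIndex s α i → IsNikolovIndex s β i →
      0 < tailMean s α i → 0 < tailMean s β i →
      phi s β - phi s α ≤ (dyadSum (fun l i => w l i) (phiWeight s α i) *
        (dyadSum (fun l i => z l i) β - dyadSum (fun l i => w l i) α)).trace := by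
    intro α β w z hw hz hα hβ hα' hβ' hα0 hβ0
    have hQ := overlap_mem_doublyStochastic hw hz
    have h1 := phi_le_add_sum_phiWeight hsk hα hβ hα' hβ' hα0 hβ0
    have h2 : Antivary (phiWeight s α i) β := fun l m h =>
      phiWeight_monotone hα hα0 (le_of_lt (not_le.1 fun hle => absurd (hβ hle) (not_le.2 h)))
    have h3 := h2.sum_mul_le_sum_doublyStochastic hQ
    have h4 := trace_sub_mul_sub_dyadSum hw hz (phiWeight s α i) α 0 β
    have h5 : ∑ l, phiWeight s α i l * α l =
        ∑ l, ∑ m, overlap w z l m * (phiWeight s α i l * α l) := by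
      simp_rw [← Finset.sum_mul, sum_row_of_mem_doublyStochastic hQ, one_mul]
    have h6 : dyadSum (fun l i => z l i) (0 : Fin k → ℝ) = 0 := by simp [dyadSum]
    rw [h6, zero_sub, neg_mul, Matrix.trace_neg] at h4
    have h7 : ∑ l, ∑ m, overlap w z l m *
          (((0 : Fin k → ℝ) m - phiWeight s α i l) * (β m - α l)) =
        ∑ l, phiWeight s α i l * α l -
          ∑ l, ∑ m, overlap w z l m * (phiWeight s α i l * β m) := by
      rw [h5]
      simp only [← Finset.sum_sub_distrib]
      refine Finset.sum_congr rfl fun l _ => Finset.sum_congr rfl fun m _ => ?_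
      rw [Pi.zero_apply]
      ring
    rw [h7] at h4
    simp only [mul_sub, Finset.sum_sub_distrib] at h1
    linarith
  have hup := hsuper hu hv hlam hmu hi hj ha hb0
  have hlow := hsuper hv hu hmu hlam hj hi hb0 ha
  rw [← hX, ← hY] at hup hlow
  have hlow' : ((dyadSum (fun l i => v l i) (phiWeight s mu i) -
        dyadSum (fun l i => u l i) (phiWeight s lam i)) * (Y - X)).trace ≤
      phi s mu - phi s lam -
        (dyadSum (fun l i => u l i) (phiWeight s lam i) * (Y - X)).trace := by
    rw [← neg_sub Y X, mul_neg, Matrix.trace_neg] at hlow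
    rw [sub_mul, Matrix.trace_sub]
    linarith
  set a := tailMean s lam i with ha'
  set b := tailMean s mu i with hb'
  set D := ((Y - X) * (Y - X)).trace with hD
  have hDeq : D = ∑ l, ∑ m, overlap u v l m * ((mu m - lam l) * (mu m - lam l)) := by
    rw [hD, hX, hY, trace_sub_mul_sub_dyadSum hu hv]
  have hHW : ∑ l, (mu l - lam l) ^ 2 ≤ D := by
    rw [hD, hX, hY]
    exact sum_sq_sub_le_trace_sq hu hv hlam hmu
  have hab : (b - a) ^ 2 ≤ k * D :=
    (sq_tailMean_sub_le hi).trans (by gcongr)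
  have hD0 : 0 ≤ D := (Finset.sum_nonneg fun l _ => sq_nonneg _).trans hHW
  have ha2 : 0 ≤ 2 / a ^ 2 := by positivity
  -- The two weights differ by a Lipschitz bound; the mixed products `|b - a| |μ_m - λ_l|` are
  -- absorbed into squares, and the total weight of the overlaps is `k`.
  have hbound : -(((dyadSum (fun l i => v l i) (phiWeight s mu i) -
        dyadSum (fun l i => u l i) (phiWeight s lam i)) * (Y - X)).trace) ≤
      2 / a ^ 2 * (2 * D + k * (b - a) ^ 2) := by
    have hsum : 2 / a ^ 2 * (2 * D + k * (b - a) ^ 2) = ∑ l, ∑ m, overlap u v l m *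
        (2 / a ^ 2 * (2 * ((mu m - lam l) * (mu m - lam l)) + (b - a) ^ 2)) := by
      have h1 : (k : ℝ) * (b - a) ^ 2 = ∑ l, ∑ m, overlap u v l m * (b - a) ^ 2 := by
        simp_rw [← Finset.sum_mul, sum_row_of_mem_doublyStochastic hP]
        simp
      rw [h1, hDeq]
      simp only [Finset.mul_sum, ← Finset.sum_add_distrib]
      exact Finset.sum_congr rfl fun l _ => Finset.sum_congr rfl fun m _ => by ring
    rw [hsum, hX, hY, trace_sub_mul_sub_dyadSum hu hv]
    simp only [← Finset.sum_neg_distrib]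
    refine Finset.sum_le_sum fun l _ => Finset.sum_le_sum fun m _ => ?_
    rw [← mul_neg]
    refine mul_le_mul_of_nonneg_left ?_ (nonneg_of_mem_doublyStochastic hP)
    have hw : |phiWeight s mu i m - phiWeight s lam i l| ≤
        2 / a ^ 2 * (|mu m - lam l| + |b - a|) := abs_one_div_max_sub_le ha hb
    calc _ ≤ |(phiWeight s mu i m - phiWeight s lam i l) * (mu m - lam l)| := neg_le_abs _
      _ = |phiWeight s mu i m - phiWeight s lam i l| * |mu m - lam l| := abs_mul _ _
      _ ≤ 2 / a ^ 2 * (|mu m - lam l| + |b - a|) * |mu m - lam l| := by gcongr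
      _ = 2 / a ^ 2 * ((|mu m - lam l| + |b - a|) * |mu m - lam l|) := mul_assoc _ _ _
      _ ≤ _ := by
        refine mul_le_mul_of_nonneg_left ?_ ha2
        rw [← abs_mul_abs_self (mu m - lam l), ← sq_abs (b - a)]
        nlinarith [sq_nonneg (|mu m - lam l| - |b - a|), sq_nonneg |b - a|,
          sq_nonneg |mu m - lam l|]
  have hfin : 2 / a ^ 2 * (2 * D + k * (b - a) ^ 2) ≤ 2 / a ^ 2 * (2 + k ^ 2) * D := by
    rw [mul_assoc]
    refine mul_le_mul_of_nonneg_left ?_ ha2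
    have hk : (k : ℝ) * (b - a) ^ 2 ≤ k * (k * D) := by gcongr
    linarith [hk]
  have hnn : 0 ≤ 2 / a ^ 2 * (2 + (k : ℝ) ^ 2) * D := by positivity
  rw [abs_le]
  constructor <;> linarith

theorem trace_sq_factMatrix_le {n k : ℕ} (F : Matrix (Fin n) (Fin k) ℝ) (x : Fin n → ℝ) :
    (factMatrix F x * factMatrix F x).trace ≤ (∑ i, ∑ j, (F.row i ⬝ᵥ F.row j) ^ 2) * ‖x‖ ^ 2 := by
  rw [factMatrix_eq_dyadSum, trace_dyadSum_mul_dyadSum]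
  simp only [Finset.sum_mul]
  refine Finset.sum_le_sum fun i _ => Finset.sum_le_sum fun j _ => ?_
  refine mul_le_mul_of_nonneg_left ?_ (sq_nonneg _)
  calc x i * x j ≤ |x i| * |x j| := by rw [← abs_mul]; exact le_abs_self _
    _ ≤ ‖x‖ * ‖x‖ :=
      mul_le_mul (norm_le_pi_norm x i) (norm_le_pi_norm x j) (abs_nonneg _) (norm_nonneg _)
    _ = ‖x‖ ^ 2 := (sq _).symm

theorem factMatrix_sub {n k : ℕ} (F : Matrix (Fin n) (Fin k) ℝ) (x y : Fin n → ℝ) :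
    factMatrix F (x - y) = factMatrix F x - factMatrix F y := by
  simp only [factMatrix_eq_dyadSum, dyadSum_sub]

theorem continuous_sortedEigenvalues_factMatrix {n k : ℕ} (F : Matrix (Fin n) (Fin k) ℝ) :
    Continuous fun x => sortedEigenvalues (factMatrix F x) := by
  refine continuous_pi fun l => ?_
  refine (LipschitzWith.of_dist_le_mul
    (K := (√(∑ i, ∑ j, (F.row i ⬝ᵥ F.row j) ^ 2)).toNNReal) fun y x => ?_).continuous
  obtain ⟨u, hu, hX⟩ := exists_orthonormal_eq_dyadSum (isHermitian_factMatrix F x)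
  obtain ⟨v, hv, hY⟩ := exists_orthonormal_eq_dyadSum (isHermitian_factMatrix F y)
  have h := sum_sq_sub_le_trace_sq hu hv
    (sortedEigenvalues_antitone (isHermitian_factMatrix F x))
    (sortedEigenvalues_antitone (isHermitian_factMatrix F y))
  rw [← hX, ← hY, ← factMatrix_sub] at h
  have h1 := (Finset.single_le_sum (f := fun l => (sortedEigenvalues (factMatrix F y) l -
    sortedEigenvalues (factMatrix F x) l) ^ 2) (fun m _ => sq_nonneg _)
    (Finset.mem_univ l)).trans (h.trans (trace_sq_factMatrix_le F (y - x)))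
  rw [Real.coe_toNNReal _ (Real.sqrt_nonneg _), Real.dist_eq, dist_eq_norm]
  refine abs_le_of_sq_le_sq (h1.trans_eq ?_) (by positivity)
  rw [mul_pow, Real.sq_sqrt (by positivity)]

theorem continuous_tailMean {k : ℕ} (s i : ℕ) :
    Continuous fun lam : Fin k → ℝ => tailMean s lam i := by
  unfold tailMean tailSum
  fun_prop

/-- If both inequalities that define the Nikolov index are strict at `λ`, the index is the same
at all vectors near `λ`. -/
theorem IsNikolovIndex.eventually {k s i : ℕ} {lam : Fin k → ℝ} (hi : IsNikolovIndex s lam i)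
    (hik : i < k) (hstrict : lam ⟨i, hik⟩ < tailMean s lam i) :
    ∀ᶠ mu in nhds lam, IsNikolovIndex s mu i := by
  have h1 : ∀ᶠ mu in nhds lam, ∀ l : Fin k, (l : ℕ) + 1 = i → tailMean s mu i < mu l := by
    refine Filter.eventually_all.2 fun l => Filter.eventually_imp_distrib_left.2 fun hl => ?_
    exact (continuous_tailMean s i).continuousAt.eventually_lt
      (continuous_apply l).continuousAt (hi.2.1 l hl)
  have h2 : ∀ᶠ mu in nhds lam, mu ⟨i, hik⟩ < tailMean s mu i :=
    (continuous_apply _).continuousAt.eventually_lt (continuous_tailMean s i).continuousAt hstrict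
  filter_upwards [h1, h2] with mu hmu1 hmu2
  refine ⟨hi.1, hmu1, fun l hl => ?_⟩
  rw [show l = ⟨i, hik⟩ from Fin.ext hl]
  exact hmu2.le

theorem trace_dyadSum_mul_factMatrix {n k : ℕ} (F : Matrix (Fin n) (Fin k) ℝ)
    (u : Fin k → EuclideanSpace ℝ (Fin k)) (w : Fin k → ℝ) (x : Fin n → ℝ) :
    (dyadSum (fun l i => u l i) w * factMatrix F x).trace =
      ∑ j, (∑ l, w l * (∑ i, F j i * u l i) ^ 2) * x j := by
  rw [factMatrix_eq_dyadSum, trace_dyadSum_mul_dyadSum, Finset.sum_comm]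
  refine Finset.sum_congr rfl fun j _ => ?_
  rw [Finset.sum_mul]
  refine Finset.sum_congr rfl fun l _ => ?_
  rw [dotProduct_comm, dotProduct]
  simp only [Matrix.row_apply]
  ring

/-- If both inequalities defining the Nikolov index are strict at `x̂` and the tail mean
is positive, then `Γ_s ∘ F` is differentiable at `x̂`. -/
theorem hasFDerivAt_Gam_factMatrix {n k s i : ℕ} (hsk : s ≤ k)
    (F : Matrix (Fin n) (Fin k) ℝ) {xhat : Fin n → ℝ} {lam : Fin k → ℝ}
    (hlam : lam = sortedEigenvalues (factMatrix F xhat))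
    {u : Fin k → EuclideanSpace ℝ (Fin k)} (hu : Orthonormal ℝ u)
    (hdec : factMatrix F xhat = dyadSum (fun l i => u l i) lam)
    (hi : IsNikolovIndex s lam i) (hik : i < k)
    (hstrict : lam ⟨i, hik⟩ < tailMean s lam i) (ha : 0 < tailMean s lam i) :
    HasFDerivAt (fun x : Fin n → ℝ => Gam s (factMatrix F x))
      (∑ j, (∑ l, phiWeight s lam i l * (∑ m, F j m * u l m) ^ 2) •
        (ContinuousLinearMap.proj j : (Fin n → ℝ) →L[ℝ] ℝ)) xhat := by
  have hanti : Antitone lam := hlam ▸ sortedEigenvalues_antitone (isHermitian_factMatrix F xhat)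
  have htend : Filter.Tendsto (fun x => sortedEigenvalues (factMatrix F x)) (nhds xhat)
      (nhds lam) := by
    rw [hlam]
    exact (continuous_sortedEigenvalues_factMatrix F).continuousAt
  have hmean : ∀ᶠ mu in nhds lam, tailMean s lam i / 2 < tailMean s mu i :=
    (continuous_tailMean s i).continuousAt.eventually_const_lt (half_lt_self ha)
  rw [hasFDerivAt_iff_isLittleO]
  have hbig : (fun x => Gam s (factMatrix F x) - Gam s (factMatrix F xhat) -
      (∑ j, (∑ l, phiWeight s lam i l * (∑ m, F j m * u l m) ^ 2) •
        (ContinuousLinearMap.proj j : (Fin n → ℝ) →L[ℝ] ℝ)) (x - xhat)) =O[nhds xhat]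
      fun x => ‖x - xhat‖ ^ 2 := by
    refine Asymptotics.IsBigO.of_bound (2 / tailMean s lam i ^ 2 * (2 + k ^ 2) *
      ∑ i, ∑ j, (F.row i ⬝ᵥ F.row j) ^ 2) ?_
    filter_upwards [htend.eventually (hi.eventually hik hstrict), htend.eventually hmean]
      with x hx1 hx2
    obtain ⟨v, hv, hY⟩ := exists_orthonormal_eq_dyadSum (isHermitian_factMatrix F x)
    have h := abs_phi_sub_sub_trace_le hsk hanti
      (sortedEigenvalues_antitone (isHermitian_factMatrix F x)) hi hx1 ha hx2.le hu hv hdec hY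
    rw [← factMatrix_sub, trace_dyadSum_mul_factMatrix] at h
    have hlin : (∑ j, (∑ l, phiWeight s lam i l * (∑ m, F j m * u l m) ^ 2) •
        (ContinuousLinearMap.proj j : (Fin n → ℝ) →L[ℝ] ℝ)) (x - xhat) =
        ∑ j, (∑ l, phiWeight s lam i l * (∑ m, F j m * u l m) ^ 2) * (x - xhat) j := by
      simp
    rw [hlin, Real.norm_eq_abs, Gam, Gam, ← hlam, norm_pow, norm_norm, mul_assoc]
    exact h.trans (mul_le_mul_of_nonneg_left (trace_sq_factMatrix_le F _) (by positivity))
  refine hbig.trans_isLittleO ?_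
  exact Asymptotics.isLittleO_pow_sub_sub xhat one_lt_two

theorem mainTheorem6 (n k s : ℕ) (hs : 0 < s) (hsk : s ≤ k)
    (F : Matrix (Fin n) (Fin k) ℝ) (xhat : Fin n → ℝ) (hx : xhat ∈ Set.Icc 0 1)
    (lam : Fin k → ℝ) (hlam : lam = sortedEigenvalues (factMatrix F xhat))
    (u : Fin k → EuclideanSpace ℝ (Fin k)) (hu : Orthonormal ℝ u)
    (hdec : factMatrix F xhat
      = ∑ l : Fin k, lam l • Matrix.vecMulVec (fun i => u l i) (fun i => u l i))
    (ι : ℕ) (hι : IsNikolovIndex s lam ι)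
    (hstrict : 1 / ((s : ℝ) - ι) * tailSum lam ι > lam ⟨ι, hι.1.trans_le hsk⟩) :
    DifferentiableAt ℝ (fun x : Fin n → ℝ => Gam s (factMatrix F x)) xhat ∧
    ∀ j : Fin n,
      HasDerivAt (fun t : ℝ => Gam s (factMatrix F (Function.update xhat j t)))
        ((∑ l : Fin k with l.val < ι, 1 / lam l * (∑ i, F j i * u l i) ^ 2) +
          ∑ l : Fin k with ι ≤ l.val,
            ((s : ℝ) - ι) / tailSum lam ι * (∑ i, F j i * u l i) ^ 2)
        (xhat j) := by
  have hanti : Antitone lam := hlam ▸ sortedEigenvalues_antitone (isHermitian_factMatrix F xhat)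
  -- The strict inequality and `F(x̂) ⪰ 0` make the tail mean positive, so that both kinds of
  -- logarithms are taken at positive numbers.
  have ha : 0 < tailMean s lam ι := by
    refine lt_of_le_of_lt ?_ hstrict
    exact (sortedEigenvalues_nonneg (posSemidef_factMatrix F hx.1) _).trans_eq
      (congrFun hlam _).symm
  have hF := hasFDerivAt_Gam_factMatrix hsk F hlam hu hdec hι (hι.1.trans_le hsk) hstrict ha
  refine ⟨hF.differentiableAt, fun j => ?_⟩
  refine (hF.comp_hasDerivAt_of_eq (xhat j) (hasDerivAt_update xhat j (xhat j))
    (Function.update_eq_self j xhat).symm).congr_deriv ?_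
  have hval : (∑ j', (∑ l, phiWeight s lam ι l * (∑ m, F j' m * u l m) ^ 2) •
      (ContinuousLinearMap.proj j' : (Fin n → ℝ) →L[ℝ] ℝ)) (Pi.single j 1) =
      ∑ l, phiWeight s lam ι l * (∑ m, F j m * u l m) ^ 2 := by
    simp [Pi.single_apply]
  rw [hval, ← Finset.sum_filter_add_sum_filter_not Finset.univ (fun l : Fin k => l.val < ι)]
  congr 1
  · refine Finset.sum_congr rfl fun l hl => ?_
    rw [hι.phiWeight_of_lt hanti (Finset.mem_filter.1 hl).2 hsk]
  · refine Finset.sum_congr (by simp) fun l hl => ?_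
    rw [hι.phiWeight_of_ge hanti (Finset.mem_filter.1 hl).2, tailMean]
    congr 1
    rw [one_div_mul_eq_div, one_div_div]
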